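/- Let $M$ be an Eulerian map, i.e. a finite connected graph with at least one edge (loops and multiple edges allowed) embedded in the sphere, with faces colored black and white so that the two sides of every edge have different colors. Orient every edge clockwise around its incident black face, and fix a vertex of $M$, the origin. Let $p\ge 0$ be an integer and let $n$ assign to each face $f$ a number $n(f)\in\{0,1,\dots,p\}$ of particles. Say that $n$ satisfies the $p$-exclusion rule if $n(f)+n(g)\le p$ for any two adjacent faces $f,g$ (faces sharing an edge), and that an edge violates the rule if its two sides $f,g$ satisfy $n(f)+n(g)>p$. Let $\mathcal B(M,n)$ be the collection of all sets $B$ of edges of $M$ (the blocked edges) such that (i) every vertex of $M$ can be reached from the origin by a path of edges not in $B$, each followed in the direction of its orientation, and (ii) every edge in $B$ violates the $p$-exclusion rule. For $y$ in a commutative ring put $Z_{M,n}(y)=\sum_{B\in\mathcal B(M,n)}y^{|B|}$. Then $$Z_{M,n}(-1)=\begin{cases}1 & \text{if } n \text{ satisfies the } p\text{-exclusion rule},\\ 0 & \text{otherwise.}\end{cases}$$ Moreover, if $n$ satisfies the $p$-exclusion rule, then $Z_{M,n}(y)=1$ for every $y$. -/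

import Mathlib

/-- A finite planar map (a connected graph embedded in the sphere, loops and multiple edges
allowed, with at least one edge) on a set `D` of darts, i.e. oriented edges: `rot` sends a dart to
the next dart counterclockwise around its tail, `rev` reverses a dart.  Planarity is Euler's
relation `V - E + F = 2`. -/
structure PlanarMap (D : Type*) [Finite D] where
  rot : Equiv.Perm D
  rev : Equiv.Perm D
  rev_rev : ∀ d, rev (rev d) = d
  rev_ne : ∀ d, rev d ≠ d
  connected : ∀ d d' : D, ∃ g ∈ Subgroup.closure {rot, rev}, g d = d'
  planar : Nat.card (Quotient (Equiv.Perm.SameCycle.setoid rot)) +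
      Nat.card (Quotient (Equiv.Perm.SameCycle.setoid (rot⁻¹ * rev))) =
    Nat.card (Quotient (Equiv.Perm.SameCycle.setoid rev)) + 2

namespace PlanarMap

variable {D : Type*} [Finite D] (M : PlanarMap D)

/-- The vertices are the cycles of `rot`. -/
def Vertex : Type _ := Quotient (Equiv.Perm.SameCycle.setoid M.rot)

/-- The unoriented edges are the cycles `{d, rev d}` of `rev`. -/
def Edge : Type _ := Quotient (Equiv.Perm.SameCycle.setoid M.rev)

/-- The faces are the cycles of `rot⁻¹ * rev`, which sends a dart `d` to the dart that follows it
on the boundary of the face lying to the left of `d`. -/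
def Face : Type _ := Quotient (Equiv.Perm.SameCycle.setoid (M.rot⁻¹ * M.rev))

/-- The vertex from which a dart emanates. -/
def tail (d : D) : M.Vertex := Quotient.mk _ d

/-- The vertex to which a dart points. -/
def head (d : D) : M.Vertex := M.tail (M.rev d)

/-- The edge that carries a dart. -/
def edge (d : D) : M.Edge := Quotient.mk _ d

/-- The face to the left of a dart. -/
def leftFace (d : D) : M.Face := Quotient.mk _ d

/-- The face to the right of a dart. -/
def rightFace (d : D) : M.Face := M.leftFace (M.rev d)

instance : Finite M.Edge := inferInstanceAs (Finite (Quotient _))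

noncomputable instance : Fintype M.Edge := Fintype.ofFinite _

/-- Two faces are adjacent if they are the two sides of a common edge. -/
def FaceAdj (f g : M.Face) : Prop := ∃ d, M.leftFace d = f ∧ M.rightFace d = g

end PlanarMap

/-- An Eulerian map: a planar map with faces colored black and white (the faces not in `black`)
such that the two sides of each edge have different colors. -/
structure EulerianMap (D : Type*) [Finite D] extends PlanarMap D where
  black : Set toPlanarMap.Face
  proper : ∀ f g, toPlanarMap.FaceAdj f g → (f ∈ black ↔ g ∉ black)

namespace EulerianMap

variable {D : Type*} [Finite D] (M : EulerianMap D)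

/-- The canonical orientation of the edges is clockwise around black faces: a dart points in the
canonical direction of its edge if its right face is black. -/
def IsForward (d : D) : Prop := M.rightFace d ∈ M.black

/-- An allowed step from `u` to `v`: along an unblocked edge, in its canonical direction. -/
def Step (B : Finset M.Edge) (u v : M.Vertex) : Prop :=
  ∃ d, M.IsForward d ∧ M.edge d ∉ B ∧ M.tail d = u ∧ M.head d = v

/-- The connectivity constraint: every vertex is attainable from the origin by an allowed path. -/
def Attainable (origin : M.Vertex) (B : Finset M.Edge) : Prop :=
  ∀ v, Relation.ReflTransGen (M.Step B) origin v

/-- The `p`-exclusion rule for the particle configuration `n`: at most `p` particles in total on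
any pair of adjacent faces. -/
def Exclusion (p : ℕ) (n : M.Face → ℕ) : Prop :=
  ∀ f g, M.FaceAdj f g → n f + n g ≤ p

/-- The edge `e` violates the `p`-exclusion rule: its two sides carry more than `p` particles. -/
def Violates (p : ℕ) (n : M.Face → ℕ) (e : M.Edge) : Prop :=
  ∃ d, M.edge d = e ∧ p < n (M.leftFace d) + n (M.rightFace d)

open Classical in
/-- The allowed blocked-edge configurations: sets of edges, all of which violate the `p`-exclusion
rule, that satisfy the connectivity constraint. -/
noncomputable def allowedBlockings (origin : M.Vertex) (p : ℕ) (n : M.Face → ℕ) :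
    Finset (Finset M.Edge) :=
  Finset.univ.filter fun B => M.Attainable origin B ∧ ∀ e ∈ B, M.Violates p n e

/-- The sum over all allowed blocked-edge configurations, with weight `y` per blocked edge. -/
noncomputable def blockingSum {R : Type*} [CommRing R] (origin : M.Vertex) (p : ℕ)
    (n : M.Face → ℕ) (y : R) : R :=
  ∑ B ∈ M.allowedBlockings origin p n, y ^ B.card

end EulerianMap

namespace PlanarMap

variable {D : Type*} [Finite D] (M : PlanarMap D)

/-! Face boundaries are directed cycles, so giving each edge the weight `n f + n g - c` yields a
circulation: its net flow out of any vertex set `X` is zero. If all edges leaving `X` violate the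
rule and no entering edge does, taking `c = p` and `c = p + 1` shows that nothing crosses
(`mem_of_forall_crossing`). Let `X` be the set of vertices reached without violating edges. If some
edge violates the rule, then one of them has its head in `X`. Blocking or unblocking this edge
preserves attainability (`Attainable.insert`), which gives a sign-reversing involution. -/

theorem leftFace_eq_of_face_step (d : D) :
    M.leftFace ((M.rot⁻¹ * M.rev) d) = M.leftFace d :=
  Quotient.sound (Equiv.Perm.sameCycle_apply_left.2 (Equiv.Perm.SameCycle.refl _ _))

theorem tail_rot (d : D) : M.tail (M.rot d) = M.tail d :=
  Quotient.sound (Equiv.Perm.sameCycle_apply_left.2 (Equiv.Perm.SameCycle.refl _ _))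

theorem tail_face_step (d : D) : M.tail ((M.rot⁻¹ * M.rev) d) = M.head d := by
  rw [← tail_rot]
  exact congrArg M.tail (M.rot.apply_symm_apply _)

theorem edge_rev (d : D) : M.edge (M.rev d) = M.edge d :=
  Quotient.sound (Equiv.Perm.sameCycle_apply_left.2 (Equiv.Perm.SameCycle.refl _ _))

theorem head_rev (d : D) : M.head (M.rev d) = M.tail d := by
  rw [head, M.rev_rev]

theorem rightFace_rev (d : D) : M.rightFace (M.rev d) = M.leftFace d := by
  rw [rightFace, M.rev_rev]

theorem eq_or_eq_rev_of_edge_eq {d d' : D} (h : M.edge d = M.edge d') :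
    d' = d ∨ d' = M.rev d := by
  obtain ⟨i, hi⟩ : M.rev.SameCycle d d' := Quotient.exact h
  have hsq : M.rev ^ (2 : ℤ) = 1 := by
    ext x
    rw [zpow_two, Equiv.Perm.mul_apply, M.rev_rev, Equiv.Perm.one_apply]
  rcases Int.even_or_odd' i with ⟨k, rfl | rfl⟩
  · left
    rw [zpow_mul, hsq, one_zpow] at hi
    exact hi.symm
  · right
    rw [zpow_add, zpow_mul, hsq, one_zpow, one_mul, zpow_one] at hi
    exact hi.symm

/-- The boundary of each face is a closed walk, so the total variation of a vertex function along
the face boundaries, weighted by a face function, vanishes. -/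
theorem sum_leftFace_mul_tail_sub_head [Fintype D] (h : M.Face → ℤ) (g : M.Vertex → ℤ) :
    ∑ d, h (M.leftFace d) * (g (M.tail d) - g (M.head d)) = 0 := by
  simp only [mul_sub, Finset.sum_sub_distrib, sub_eq_zero]
  rw [← Equiv.sum_comp (M.rot⁻¹ * M.rev)]
  simp only [leftFace_eq_of_face_step, tail_face_step]

/-- A nonempty set of vertices that no dart leaves contains all vertices. -/
theorem mem_of_forall_head_mem {X : Set M.Vertex} {v₀ : M.Vertex} (h₀ : v₀ ∈ X)
    (hX : ∀ d, M.tail d ∈ X → M.head d ∈ X) (v : M.Vertex) : v ∈ X := by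
  obtain ⟨d₀, rfl⟩ := Quotient.exists_rep v₀
  obtain ⟨d, rfl⟩ := Quotient.exists_rep v
  obtain ⟨g, hg, rfl⟩ := M.connected d₀ d
  have key : ∀ x, M.tail (g x) ∈ X ↔ M.tail x ∈ X := by
    induction hg using Subgroup.closure_induction with
    | mem s hs =>
      intro x
      rcases hs with rfl | rfl
      · rw [tail_rot]
      · exact ⟨fun h => M.head_rev x ▸ hX _ h, hX x⟩
    | one => exact fun _ => Iff.rfl
    | mul a b _ _ ha hb => exact fun x => (ha (b x)).trans (hb x)
    | inv a _ ha => exact fun x => by simpa using (ha (a⁻¹ x)).symm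
  exact (key d₀).2 h₀

end PlanarMap

namespace EulerianMap

variable {D : Type*} [Finite D] (M : EulerianMap D)

theorem isForward_iff_leftFace (d : D) : M.IsForward d ↔ M.leftFace d ∉ M.black := by
  have h := M.proper _ _ ⟨d, rfl, rfl⟩
  rw [IsForward]
  tauto

theorem isForward_rev_iff (d : D) : M.IsForward (M.rev d) ↔ ¬ M.IsForward d := by
  rw [isForward_iff_leftFace]
  rfl

theorem eq_of_isForward_of_edge_eq {d d' : D} (hd : M.IsForward d) (hd' : M.IsForward d')
    (h : M.edge d = M.edge d') : d' = d := by
  rcases M.eq_or_eq_rev_of_edge_eq h with h | rfl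
  · exact h
  · exact absurd hd ((M.isForward_rev_iff d).1 hd')

theorem violates_edge_iff (p : ℕ) (n : M.Face → ℕ) (d : D) :
    M.Violates p n (M.edge d) ↔ p < n (M.leftFace d) + n (M.rightFace d) := by
  refine ⟨?_, fun h => ⟨d, rfl, h⟩⟩
  rintro ⟨d', hd', h⟩
  rcases M.eq_or_eq_rev_of_edge_eq hd' with rfl | rfl
  · exact h
  · rw [M.rightFace_rev, add_comm]
    exact h

theorem exists_isForward_edge_eq (e : M.Edge) : ∃ d, M.IsForward d ∧ M.edge d = e := by
  obtain ⟨d, rfl⟩ := Quotient.exists_rep e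
  by_cases h : M.IsForward d
  · exact ⟨d, h, rfl⟩
  · exact ⟨M.rev d, (M.isForward_rev_iff d).2 h, M.edge_rev d⟩

theorem exclusion_iff (p : ℕ) (n : M.Face → ℕ) :
    M.Exclusion p n ↔ ∀ e, ¬ M.Violates p n e := by
  constructor
  · rintro h _ ⟨d, -, hd⟩
    exact absurd (h _ _ ⟨d, rfl, rfl⟩) (not_le.2 hd)
  · rintro h _ _ ⟨d, rfl, rfl⟩
    exact not_lt.1 fun hd => h _ ⟨d, rfl, hd⟩

/-! ### Circulation and directed cuts -/

open Classical in
/-- Flow conservation: the sum over the canonically oriented edges of the variation of a vertex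
function, weighted by the sum of a face function over the two sides shifted by a constant,
vanishes. -/
theorem sum_isForward_weight_mul_tail_sub_head [Fintype D] (n : M.Face → ℤ) (c : ℤ)
    (g : M.Vertex → ℤ) :
    ∑ d with M.IsForward d,
      (n (M.leftFace d) + n (M.rightFace d) - c) * (g (M.tail d) - g (M.head d)) = 0 := by
  -- Each edge has exactly one white side, so `c` is charged to white faces only.
  have hwhite := M.sum_leftFace_mul_tail_sub_head
    (fun f => if f ∉ M.black then n f - c else 0) g
  have hblack := M.sum_leftFace_mul_tail_sub_head
    (fun f => if f ∉ M.black then 0 else n f) g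
  rw [← Equiv.sum_comp M.rev] at hblack
  simp only [← M.isForward_iff_leftFace, isForward_rev_iff] at hwhite hblack
  refine Eq.trans ?_ (sub_eq_zero.2 (hwhite.trans hblack.symm))
  rw [Finset.sum_filter, ← Finset.sum_sub_distrib]
  refine Finset.sum_congr rfl fun d _ => ?_
  rw [M.head_rev]
  change _ = _ - (ite _ _ (n (M.rightFace d))) * (g (M.head d) - _)
  by_cases hd : M.IsForward d
  · simp only [hd, if_true, not_true, if_false]
    ring
  · simp [hd]

/-- If every edge leaving a set of vertices violates the exclusion rule and no edge entering it
does, then the set is empty or contains all vertices. -/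
theorem mem_of_forall_crossing {p : ℕ} {n : M.Face → ℕ} {X : Set M.Vertex} {v₀ : M.Vertex}
    (h₀ : v₀ ∈ X)
    (hout : ∀ d, M.IsForward d → M.tail d ∈ X → M.head d ∉ X → M.Violates p n (M.edge d))
    (hin : ∀ d, M.IsForward d → M.tail d ∉ X → M.head d ∈ X → ¬ M.Violates p n (M.edge d))
    (v : M.Vertex) : v ∈ X := by
  classical
  have := Fintype.ofFinite D
  simp only [violates_edge_iff, not_lt] at hout hin
  let g : M.Vertex → ℤ := fun u => if u ∈ X then 1 else 0
  -- For these `c`, outgoing weights are nonnegative and incoming ones nonpositive, so every term of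
  -- the vanishing sum is nonnegative.
  have hzero : ∀ c : ℤ, (p : ℤ) ≤ c → c ≤ p + 1 → ∀ d, M.IsForward d →
      ((n (M.leftFace d) : ℤ) + n (M.rightFace d) - c) * (g (M.tail d) - g (M.head d)) = 0 := by
    intro c hc hc' d hd
    have hsum := M.sum_isForward_weight_mul_tail_sub_head (fun f => (n f : ℤ)) c g
    refine (Finset.sum_eq_zero_iff_of_nonneg fun d hd => ?_).1 hsum d (by simpa using hd)
    have hd : M.IsForward d := by simpa using hd
    by_cases ht : M.tail d ∈ X <;> by_cases hh : M.head d ∈ X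
    · simp [g, ht, hh]
    · have := hout d hd ht hh
      simp only [g, ht, hh, if_true, if_false]
      omega
    · have := hin d hd ht hh
      simp only [g, ht, hh, if_true, if_false]
      omega
    · simp [g, ht, hh]
  have hiff : ∀ d, M.IsForward d → (M.tail d ∈ X ↔ M.head d ∈ X) := by
    intro d hd
    -- `c = p` makes outgoing terms positive, excluding such edges; `c = p + 1` does the same for
    -- incoming ones.
    have h₁ := hzero p le_rfl (by omega) d hd
    have h₂ := hzero (p + 1) (by omega) le_rfl d hd
    by_cases ht : M.tail d ∈ X <;> by_cases hh : M.head d ∈ X <;>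
      simp only [g, ht, hh, if_true, if_false] at h₁ h₂ ⊢ <;> omega
  refine M.mem_of_forall_head_mem h₀ (fun d => ?_) v
  by_cases hd : M.IsForward d
  · exact (hiff d hd).1
  · have h := hiff (M.rev d) ((M.isForward_rev_iff d).2 hd)
    rw [M.head_rev] at h
    exact h.2

/-! ### Attainability under blocking -/

theorem Step.mono {B B' : Finset M.Edge} (h : B ⊆ B') {u v : M.Vertex} (huv : M.Step B' u v) :
    M.Step B u v := by
  obtain ⟨d, hd, hB, hu, hv⟩ := huv
  exact ⟨d, hd, fun hmem => hB (h hmem), hu, hv⟩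

theorem Attainable.mono {origin : M.Vertex} {B B' : Finset M.Edge} (h : B ⊆ B')
    (hB' : M.Attainable origin B') : M.Attainable origin B :=
  fun v => Relation.ReflTransGen.mono (fun _ _ => Step.mono M h) _ _ (hB' v)

/-- If `V` is the set of violating edges, then every vertex is attainable without `V`, unless some
edge of `V` points to a vertex that is attainable without `V`. -/
theorem attainable_or_exists_head {p : ℕ} {n : M.Face → ℕ} {V : Finset M.Edge}
    (hV : ∀ e, e ∈ V ↔ M.Violates p n e) (origin : M.Vertex) :
    M.Attainable origin V ∨ ∃ d, M.IsForward d ∧ M.edge d ∈ V ∧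
      Relation.ReflTransGen (M.Step V) origin (M.head d) := by
  by_cases h : ∃ d, M.IsForward d ∧ M.edge d ∈ V ∧
      Relation.ReflTransGen (M.Step V) origin (M.head d)
  · exact Or.inr h
  · push Not at h
    refine Or.inl (M.mem_of_forall_crossing (p := p) (n := n)
      (X := {v | Relation.ReflTransGen (M.Step V) origin v}) Relation.ReflTransGen.refl ?_ ?_)
    · intro d hd ht hh
      rw [← hV]
      by_contra hdV
      exact hh (Relation.ReflTransGen.tail ht ⟨d, hd, hdV, rfl, rfl⟩)
    · intro d hd _ hh hviol
      exact h d hd ((hV _).2 hviol) hh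

/-- With no particles nothing violates the rule, and no edge leaves the reachable set, so the cut
lemma applies. -/
theorem attainable_empty (origin : M.Vertex) : M.Attainable origin ∅ := by
  refine M.mem_of_forall_crossing (p := 0) (n := fun _ => 0)
    (X := {v | Relation.ReflTransGen (M.Step ∅) origin v}) Relation.ReflTransGen.refl ?_ ?_
  · intro d hd ht hh
    exact absurd (Relation.ReflTransGen.tail ht ⟨d, hd, by simp, rfl, rfl⟩) hh
  · rintro d - - - ⟨d', -, h⟩
    simp at h

open Classical in
/-- An edge pointing to a vertex that is attainable without using any edge of `V` can be blocked
without affecting attainability. -/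
theorem Attainable.insert {origin : M.Vertex} {B V : Finset M.Edge} {d : D}
    (hd : M.IsForward d) (hhead : Relation.ReflTransGen (M.Step V) origin (M.head d))
    (hB : Insert.insert (M.edge d) B ⊆ V) (h : M.Attainable origin B) :
    M.Attainable origin (Insert.insert (M.edge d) B) := by
  intro v
  induction h v with
  | refl => exact Relation.ReflTransGen.refl
  | tail _ huv ih =>
    obtain ⟨d', hd', hB', rfl, rfl⟩ := huv
    by_cases he : M.edge d = M.edge d'
    · rw [M.eq_of_isForward_of_edge_eq hd hd' he]
      -- The path up to and including the newly blocked edge is replaced by one avoiding all of `V`.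
      exact Relation.ReflTransGen.mono (fun _ _ => Step.mono M hB) _ _ hhead
    · refine ih.tail ⟨d', hd', ?_, rfl, rfl⟩
      rw [Finset.mem_insert, not_or]
      exact ⟨Ne.symm he, hB'⟩

variable {R : Type*} [CommRing R]

theorem blockingSum_of_exclusion (origin : M.Vertex) {p : ℕ} {n : M.Face → ℕ}
    (h : M.Exclusion p n) (y : R) : M.blockingSum origin p n y = 1 := by
  have hset : M.allowedBlockings origin p n = {∅} := by
    ext B
    simp only [allowedBlockings, Finset.mem_filter_univ, Finset.mem_singleton]
    constructor
    · rintro ⟨-, hB⟩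
      exact Finset.eq_empty_of_forall_notMem fun e he => (M.exclusion_iff p n).1 h e (hB e he)
    · rintro rfl
      exact ⟨M.attainable_empty origin, by simp⟩
  simp [blockingSum, hset]

theorem blockingSum_neg_one_of_not_exclusion (origin : M.Vertex) {p : ℕ} {n : M.Face → ℕ}
    (h : ¬ M.Exclusion p n) : M.blockingSum origin p n (-1 : R) = 0 := by
  classical
  let V : Finset M.Edge := {e | M.Violates p n e}
  have hV : ∀ e, e ∈ V ↔ M.Violates p n e := fun e => by simp [V]
  obtain ⟨d, hd, hdV, hhead⟩ : ∃ d, M.IsForward d ∧ M.edge d ∈ V ∧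
      Relation.ReflTransGen (M.Step V) origin (M.head d) := by
    -- If everything is attainable without `V`, any violating edge will do.
    refine (M.attainable_or_exists_head hV origin).elim (fun hall => ?_) id
    rw [exclusion_iff] at h
    push Not at h
    obtain ⟨e, he⟩ := h
    obtain ⟨d, hd, rfl⟩ := M.exists_isForward_edge_eq e
    exact ⟨d, hd, (hV _).2 he, hall _⟩
  have hmem : ∀ B, B ∈ M.allowedBlockings origin p n ↔ M.Attainable origin B ∧ B ⊆ V := by
    intro B
    simp only [allowedBlockings, Finset.mem_filter_univ, Finset.subset_iff, hV]
  -- Toggling the edge of `d` changes `B.card` by one.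
  refine Finset.sum_involution
    (fun B _ => if M.edge d ∈ B then B.erase (M.edge d) else Insert.insert (M.edge d) B)
    ?_ ?_ ?_ ?_
  · intro B _
    split_ifs with he
    · rw [← Finset.card_erase_add_one he, pow_succ]
      ring
    · rw [Finset.card_insert_of_notMem he, pow_succ]
      ring
  · intro B _ _ heq
    split_ifs at heq with he
    · exact Finset.erase_eq_self.1 heq he
    · exact he (Finset.insert_eq_self.1 heq)
  · intro B hB
    obtain ⟨hatt, hsub⟩ := (hmem B).1 hB
    rw [hmem]
    split_ifs with he
    · exact ⟨Attainable.mono M (Finset.erase_subset _ _) hatt,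
        (Finset.erase_subset _ _).trans hsub⟩
    · have hins := Finset.insert_subset hdV hsub
      exact ⟨Attainable.insert M hd hhead hins hatt, hins⟩
  · intro B _
    by_cases he : M.edge d ∈ B <;> simp [he]

end EulerianMap

theorem mainTheorem5 {D : Type*} [Finite D] (M : EulerianMap D) (origin : M.Vertex)
    (p : ℕ) (n : M.Face → ℕ) (hn : ∀ f, n f ≤ p) {R : Type*} [CommRing R] :
    (M.Exclusion p n → ∀ y : R, M.blockingSum origin p n y = 1) ∧
    (M.Exclusion p n → M.blockingSum origin p n (-1 : R) = 1) ∧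
    (¬ M.Exclusion p n → M.blockingSum origin p n (-1 : R) = 0) :=
  ⟨fun h y => M.blockingSum_of_exclusion origin h y,
    fun h => M.blockingSum_of_exclusion origin h (-1),
    fun h => M.blockingSum_neg_one_of_not_exclusion origin h⟩
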